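/- Let $n\ge 2$. For $\nu\in\mathbb{R}$ put $H_\nu=\{x\in\mathbb{R}^n : x_1+\dots+x_n=\nu\}$, and let $e_1,\dots,e_n$ be the standard basis of $\mathbb{R}^n$. The cyclohedron is the polytope $W_n=\sum_{F}\Delta_F\subset\mathbb{R}^n$, the Minkowski sum taken over all non-empty connected sets $F\subseteq[n]$ of vertices of the cycle graph $C_n$ (for $n=2$ the graph with a single edge), where $\Delta_F=\mathrm{Conv}\{e_i : i\in F\}$. It lies in one of the hyperplanes $H_\nu$; let $W_n^0\subset H_0$ be its image under the translation $x\mapsto x-\frac{\nu}{n}(e_1+\dots+e_n)$. The dual cyclohedron is the polar dual inside $H_0$, $$W_n^\circ=\{y\in H_0 : \langle y,x\rangle\le 1\ \text{ for all } x\in W_n^0\}.$$ A quasi-metric on $[n]$ is a function $\rho:[n]\times[n]\to\mathbb{R}_{\ge 0}$ such that $\rho(i,j)=0$ if and only if $i=j$, and $\rho(i,k)\le\rho(i,j)+\rho(j,k)$ for all $i,j,k\in[n]$. Theorem. There exists a quasi-metric $\rho$ on $[n]$ such that the Kantorovich–Rubinstein polytope $$KR(\rho)=\mathrm{Conv}\left\{\frac{e_i-e_j}{\rho(i,j)}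 : 1\le i\ne j\le n\right\}$$ is affinely isomorphic to $W_n^\circ$ (some affine map $\mathbb{R}^n\to\mathbb{R}^n$ restricts to a bijection $KR(\rho)\to W_n^\circ$), and moreover $\rho(i,k)<\rho(i,j)+\rho(j,k)$ for all pairwise distinct $i,j,k\in[n]$. -/

import Mathlib

open scoped Pointwise

namespace Cyclohedron

/-- A quasi-metric (asymmetric distance function) on `X`. -/
structure IsQuasiMetric {X : Type*} (ρ : X → X → ℝ) : Prop where
  nonneg : ∀ x y, 0 ≤ ρ x y
  eq_zero_iff : ∀ x y, ρ x y = 0 ↔ x = y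
  triangle : ∀ x y z, ρ x z ≤ ρ x y + ρ y z

/-- The Kantorovich–Rubinstein polytope
`KR(ρ) = Conv {(e_x - e_y) / ρ(x, y) | x ≠ y} ⊆ ℝ^X`. -/
def KR {X : Type*} [Fintype X] [DecidableEq X] (ρ : X → X → ℝ) : Set (EuclideanSpace ℝ X) :=
  convexHull ℝ {v | ∃ x y : X, x ≠ y ∧
    v = (ρ x y)⁻¹ • (EuclideanSpace.single x (1 : ℝ) - EuclideanSpace.single y (1 : ℝ))}

/-- The simplex `Δ_F = Conv {e_i | i ∈ F} ⊆ ℝ^V` spanned by a set `F` of vertices. -/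
def simplex {V : Type*} [Fintype V] [DecidableEq V] (F : Finset V) : Set (EuclideanSpace ℝ V) :=
  convexHull ℝ {v | ∃ i ∈ F, v = EuclideanSpace.single i (1 : ℝ)}

open Classical in
/-- The graphical building set `Con(G)`: all vertex sets `F` whose induced subgraph is connected
(connected graphs are non-empty, so the empty set is excluded). -/
noncomputable def connectedSets {V : Type*} [Fintype V] (G : SimpleGraph V) :
    Finset (Finset V) :=
  Finset.univ.filter fun F => (G.induce (F : Set V)).Connected

/-- The cyclohedron `W_n`, as the Minkowski sum of the simplices `Δ_F` over all connected sets `F`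
of vertices of the cycle graph `C_n`. -/
noncomputable def cyclohedron (n : ℕ) : Set (EuclideanSpace ℝ (Fin n)) :=
  ∑ F ∈ connectedSets (SimpleGraph.cycleGraph n), simplex F

/-- The hyperplane `H_0 = {x ∈ ℝⁿ | x_1 + ⋯ + x_n = 0}`. -/
def H₀ (n : ℕ) : Set (EuclideanSpace ℝ (Fin n)) := {x | ∑ i, x i = 0}

/-- The projection of `ℝⁿ` to `H_0` along `e_1 + ⋯ + e_n`. On each hyperplane
`{x | x_1 + ⋯ + x_n = ν}` it is the translation by `-(ν / n) (e_1 + ⋯ + e_n)`. -/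
noncomputable def center {n : ℕ} (x : EuclideanSpace ℝ (Fin n)) : EuclideanSpace ℝ (Fin n) :=
  x - ((∑ i, x i) / (n : ℝ)) • ∑ i, EuclideanSpace.single i (1 : ℝ)

/-- The polar dual, inside `H_0`, of a set `K`. -/
def polarDual {n : ℕ} (K : Set (EuclideanSpace ℝ (Fin n))) : Set (EuclideanSpace ℝ (Fin n)) :=
  {y | y ∈ H₀ n ∧ ∀ x ∈ K, inner ℝ y x ≤ 1}

/-- The dual cyclohedron `W_n°`: the polar dual, inside `H_0`, of the copy of `W_n` in `H_0`. -/
noncomputable def dualCyclohedron (n : ℕ) : Set (EuclideanSpace ℝ (Fin n)) :=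
  polarDual (center '' cyclohedron n)

/-- Two convex sets are affinely isomorphic if some affine map of the ambient spaces restricts to
a bijection between them. -/
def AffinelyIsomorphic {E F : Type*} [AddCommGroup E] [Module ℝ E] [AddCommGroup F] [Module ℝ F]
    (P : Set E) (Q : Set F) : Prop :=
  ∃ f : E →ᵃ[ℝ] F, Set.BijOn f P Q

end Cyclohedron

namespace Cyclohedron

open Finset

/-! ### Connected vertex sets and the strict submodularity of the facet distance -/

section Combinatorics

/-! The proper connected sets of the cycle are the arcs `[i, j)` with `i ≠ j` (`exists_eq_arc`), so
they match the roots `e_i - e_j`. On `W_n` the coordinate sum over `F` is at least `tubeCount F`;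
after centring, this inequality puts `-center (indicatorVec F) / facetDistance F` in the polar dual.
The linear map `telescope` sends `e_i - e_j` to `-center (indicatorVec (arc i j))`, so `ρ i j =
facetDistance (arc i j)` is the natural weight.

Counting connected subsets is strictly supermodular, which makes `facetDistance` strictly submodular
and gives the strict triangle inequality (`facetDistance_arc_lt_add`). Vertex-transitivity gives
positivity (`facetDistance_pos`).

It remains to see that these vectors span the whole polar dual (`polarDual_subset`). In
`neg_center_mem_smul` a vector is decomposed greedily into indicators of connected sets, along which
the support function of `W_n` is additive. -/

theorem mem_connectedSets {V : Type*} [Fintype V] {G : SimpleGraph V} {F : Finset V} :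
    F ∈ connectedSets G ↔ (G.induce (F : Set V)).Connected := by
  simp [connectedSets]

variable {V : Type*} [Fintype V] {G : SimpleGraph V}

theorem nonempty_of_mem_connectedSets {F : Finset V} (hF : F ∈ connectedSets G) : F.Nonempty := by
  obtain ⟨v, hv⟩ := (mem_connectedSets.1 hF).nonempty
  exact ⟨v, hv⟩

theorem singleton_mem_connectedSets (v : V) : {v} ∈ connectedSets G := by
  rw [mem_connectedSets, coe_singleton]
  have : Subsingleton ({v} : Set V) := Set.subsingleton_coe _ |>.2 Set.subsingleton_singleton
  have : Nonempty ({v} : Set V) := ⟨⟨v, rfl⟩⟩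
  exact { preconnected := SimpleGraph.Preconnected.of_subsingleton }

theorem univ_mem_connectedSets (h : G.Connected) : univ ∈ connectedSets G := by
  rw [mem_connectedSets, coe_univ]
  exact (SimpleGraph.induceUnivIso G).connected_iff.2 h

/-- A property of vertices that propagates along the edges inside a connected set and holds
somewhere in this set holds everywhere in it. -/
theorem forall_mem_of_mem_connectedSets {F : Finset V} (hF : F ∈ connectedSets G) {p : V → Prop}
    {a : V} (ha : a ∈ F) (hpa : p a)
    (hp : ∀ u ∈ F, ∀ v ∈ F, G.Adj u v → p u → p v) : ∀ v ∈ F, p v := by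
  intro v hv
  obtain ⟨w⟩ := (mem_connectedSets.1 hF).preconnected ⟨a, ha⟩ ⟨v, hv⟩
  have key : ∀ x y : (F : Set V), (G.induce (F : Set V)).Walk x y → p x → p y := by
    intro x y w
    induction w with
    | nil => exact id
    | @cons x y z h w ih => exact fun hx ↦ ih (hp _ x.2 _ y.2 h hx)
  exact key _ _ w hpa

theorem map_mem_connectedSets (σ : G ≃g G) {F : Finset V} (hF : F ∈ connectedSets G) :
    F.map σ.toEquiv.toEmbedding ∈ connectedSets G := by
  rw [mem_connectedSets] at *
  refine hF.map (SimpleGraph.induceHom σ.toHom fun x hx ↦ ?_) fun y ↦ ?_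
  · exact mem_coe.2 (mem_map_of_mem σ.toEquiv.toEmbedding (mem_coe.1 hx))
  · obtain ⟨x, hx, hxy⟩ := mem_map.1 (mem_coe.1 y.2)
    exact ⟨⟨x, hx⟩, Subtype.ext hxy⟩

variable [DecidableEq V]

theorem pair_mem_connectedSets {u v : V} (h : G.Adj u v) : {u, v} ∈ connectedSets G := by
  rw [mem_connectedSets, coe_pair]
  exact SimpleGraph.induce_pair_connected_of_adj h

theorem union_mem_connectedSets {A B : Finset V} (hA : A ∈ connectedSets G)
    (hB : B ∈ connectedSets G) (h : (A ∩ B).Nonempty) : A ∪ B ∈ connectedSets G := by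
  rw [mem_connectedSets] at *
  rw [coe_union]
  exact SimpleGraph.induce_union_connected hA.preconnected hB.preconnected (by exact_mod_cast h)

/-- The number of connected sets of vertices contained in `F`. -/
noncomputable def tubeCount (G : SimpleGraph V) (F : Finset V) : ℕ :=
  #{A ∈ connectedSets G | A ⊆ F}

/-- The distance from the barycentre to the facet hyperplane of the graph associahedron with
normal vector the indicator function of `F`. -/
noncomputable def facetDistance (G : SimpleGraph V) (F : Finset V) : ℝ :=
  (#(connectedSets G) : ℝ) / Fintype.card V * #F - tubeCount G F

theorem tubeCount_add_le (A B : Finset V) :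
    tubeCount G A + tubeCount G B ≤ tubeCount G (A ∩ B) +
      #{S ∈ connectedSets G | S ⊆ A ∨ S ⊆ B} := by
  rw [filter_or, tubeCount, tubeCount, ← card_union_add_card_inter, ← filter_and, add_comm]
  simp [tubeCount, subset_inter_iff]

/-- Strict supermodularity of the number of connected subsets. -/
theorem tubeCount_add_lt {A B S : Finset V} (hS : S ∈ connectedSets G) (hSU : S ⊆ A ∪ B)
    (hSA : ¬ S ⊆ A) (hSB : ¬ S ⊆ B) :
    tubeCount G A + tubeCount G B < tubeCount G (A ∩ B) + tubeCount G (A ∪ B) := by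
  refine (tubeCount_add_le A B).trans_lt (Nat.add_lt_add_left (card_lt_card ?_) _)
  refine (ssubset_iff_of_subset fun T hT ↦ ?_).2
    ⟨S, mem_filter.2 ⟨hS, hSU⟩, fun h ↦ (mem_filter.1 h).2.elim hSA hSB⟩
  obtain ⟨hT, h⟩ := mem_filter.1 hT
  exact mem_filter.2 ⟨hT, h.elim (fun h ↦ h.trans subset_union_left)
    fun h ↦ h.trans subset_union_right⟩

theorem tubeCount_empty : tubeCount G ∅ = 0 := by
  rw [tubeCount, card_eq_zero, filter_eq_empty_iff]
  intro A hA h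
  exact (nonempty_of_mem_connectedSets hA).ne_empty (subset_empty.1 h)

theorem tubeCount_univ : tubeCount G univ = #(connectedSets G) := by
  simp [tubeCount]

theorem facetDistance_empty : facetDistance G ∅ = 0 := by
  simp [facetDistance, tubeCount_empty]

theorem facetDistance_univ [Nonempty V] : facetDistance G univ = 0 := by
  simp [facetDistance, tubeCount_univ]

/-- The cardinality term is modular, so strict supermodularity of `tubeCount` passes to its
negative. -/
theorem facetDistance_inter_add_union_lt {A B S : Finset V} (hS : S ∈ connectedSets G)
    (hSU : S ⊆ A ∪ B) (hSA : ¬ S ⊆ A) (hSB : ¬ S ⊆ B) :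
    facetDistance G (A ∩ B) + facetDistance G (A ∪ B) <
      facetDistance G A + facetDistance G B := by
  have h1 := tubeCount_add_lt hS hSU hSA hSB
  have h2 : (#(A ∩ B) : ℝ) + #(A ∪ B) = #A + #B := by exact_mod_cast card_inter_add_card_union A B
  have h3 : (tubeCount G A : ℝ) + tubeCount G B < tubeCount G (A ∩ B) + tubeCount G (A ∪ B) := by
    exact_mod_cast h1
  simp only [facetDistance]
  linear_combination h3 + (#(connectedSets G) : ℝ) / Fintype.card V * h2

/-- The coordinates of the barycentre of the Minkowski sum: all are equal if the graph is
vertex-transitive. -/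
theorem sum_inv_card_of_transitive [Nonempty V] (hG : ∀ u v : V, ∃ σ : G ≃g G, σ u = v) (v : V) :
    ∑ A ∈ connectedSets G with v ∈ A, (#A : ℝ)⁻¹ =
      (#(connectedSets G) : ℝ) / Fintype.card V := by
  -- An automorphism taking `u` to `v` injects the connected sets through `u` into those through `v`
  -- and preserves size. Exchanging `u` and `v` gives equality.
  have hle : ∀ (u v : V), ∑ A ∈ connectedSets G with u ∈ A, (#A : ℝ)⁻¹ ≤
      ∑ A ∈ connectedSets G with v ∈ A, (#A : ℝ)⁻¹ := by
    intro u v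
    obtain ⟨σ, rfl⟩ := hG u v
    have : ∑ A ∈ connectedSets G with u ∈ A, (#A : ℝ)⁻¹ =
        ∑ A ∈ ({A ∈ connectedSets G | u ∈ A}).map
          (mapEmbedding σ.toEquiv.toEmbedding).toEmbedding, (#A : ℝ)⁻¹ := by
      simp [sum_map]
    rw [this]
    refine sum_le_sum_of_subset_of_nonneg (fun A hA ↦ ?_) fun _ _ _ ↦ by positivity
    obtain ⟨B, hB, rfl⟩ := mem_map.1 hA
    obtain ⟨hB, hu⟩ := mem_filter.1 hB
    exact mem_filter.2 ⟨map_mem_connectedSets σ hB, mem_map_of_mem σ.toEquiv.toEmbedding hu⟩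
  have htot : ∑ u : V, ∑ A ∈ connectedSets G with u ∈ A, (#A : ℝ)⁻¹ = #(connectedSets G) := by
    simp_rw [sum_filter]
    rw [sum_comm, card_eq_sum_ones, Nat.cast_sum]
    refine sum_congr rfl fun A hA ↦ ?_
    have : (#A : ℝ) ≠ 0 := by
      exact_mod_cast (nonempty_of_mem_connectedSets hA).card_pos.ne'
    rw [← sum_filter, sum_const, filter_mem_eq_inter, univ_inter, nsmul_eq_mul,
      mul_inv_cancel₀ this, Nat.cast_one]
  rw [sum_congr rfl fun u _ ↦ le_antisymm (hle u v) (hle v u), sum_const, card_univ,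
    nsmul_eq_mul] at htot
  rw [← htot, mul_div_cancel_left₀]
  exact_mod_cast Fintype.card_ne_zero

/-- By transitivity, the distance is the sum over connected `A` of `#(A ∩ F) / #A` minus `1` if `A ⊆
F`. No term is negative, and `A = univ` contributes strictly. -/
theorem facetDistance_pos (hconn : G.Connected) (hG : ∀ u v : V, ∃ σ : G ≃g G, σ u = v)
    {F : Finset V} (hF : F.Nonempty) (hF' : F ≠ univ) : 0 < facetDistance G F := by
  have : Nonempty V := hconn.nonempty
  have h1 : (#(connectedSets G) : ℝ) / Fintype.card V * #F =
      ∑ A ∈ connectedSets G, (#(A ∩ F) : ℝ) / #A := by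
    calc (#(connectedSets G) : ℝ) / Fintype.card V * #F
        = ∑ v ∈ F, ∑ A ∈ connectedSets G with v ∈ A, (#A : ℝ)⁻¹ := by
          rw [sum_congr rfl fun v _ ↦ sum_inv_card_of_transitive hG v, sum_const, nsmul_eq_mul,
            mul_comm]
      _ = _ := by
          simp_rw [sum_filter]
          rw [sum_comm]
          refine sum_congr rfl fun A _ ↦ ?_
          rw [← sum_filter, sum_const, filter_mem_eq_inter, inter_comm, nsmul_eq_mul,
            div_eq_mul_inv]
  have h2 : (tubeCount G F : ℝ) = ∑ A ∈ connectedSets G, if A ⊆ F then (1 : ℝ) else 0 := by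
    simp [tubeCount]
  rw [facetDistance, h1, h2, sub_pos]
  refine sum_lt_sum (fun A hA ↦ ?_) ⟨univ, univ_mem_connectedSets hconn, ?_⟩
  · split_ifs with h
    · rw [inter_eq_left.2 h, div_self]
      exact_mod_cast (nonempty_of_mem_connectedSets hA).card_pos.ne'
    · positivity
  · rw [if_neg fun h ↦ hF' (univ_subset_iff.1 h), univ_inter]
    have := hF.card_pos
    have := Fintype.card_pos (α := V)
    rw [card_univ]
    positivity

end Combinatorics

/-! ### Arcs of the cycle and the quasi-metric -/

section Arcs

variable {n : ℕ}

/-- The cyclic interval `[i, j)`, empty if `i = j`. -/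
def arc (i j : Fin n) : Finset (Fin n) :=
  univ.filter fun m ↦ (i.val ≤ m.val ∧ m.val < j.val) ∨
    (j.val < i.val ∧ (i.val ≤ m.val ∨ m.val < j.val))

theorem mem_arc {i j m : Fin n} :
    m ∈ arc i j ↔ (i.val ≤ m ∧ m.val < j) ∨ (j.val < i ∧ (i.val ≤ m ∨ m.val < j)) := by
  simp [arc]

theorem arc_self (i : Fin n) : arc i i = ∅ := by
  ext m
  simp only [mem_arc, notMem_empty, iff_false]
  omega

theorem left_mem_arc {i j : Fin n} (h : i ≠ j) : i ∈ arc i j := by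
  rw [mem_arc]
  have := Fin.val_ne_of_ne h
  omega

theorem right_notMem_arc (i j : Fin n) : j ∉ arc i j := by
  rw [mem_arc]
  omega

theorem cycleGraph_adj_iff (hn : 2 ≤ n) {u v : Fin n} :
    (SimpleGraph.cycleGraph n).Adj u v ↔ u.val + 1 = v ∨ v.val + 1 = u ∨
      (u.val = 0 ∧ v.val + 1 = n) ∨ (v.val = 0 ∧ u.val + 1 = n) := by
  rw [SimpleGraph.cycleGraph_adj']
  have hu := u.isLt
  have hv := v.isLt
  have key : ∀ a b : Fin n, (a - b).val = 1 ↔ b.val + 1 = a ∨ (a.val = 0 ∧ b.val + 1 = n) := by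
    intro a b
    have ha := a.isLt
    have hb := b.isLt
    rcases le_or_gt b a with h | h
    · rw [Fin.sub_val_of_le h]
      rw [Fin.le_def] at h
      omega
    · rw [Fin.coe_sub_iff_lt.2 h]
      rw [Fin.lt_def] at h
      omega
  rw [key, key]
  omega

theorem cycleGraph_transitive (u v : Fin n) :
    ∃ σ : SimpleGraph.cycleGraph n ≃g SimpleGraph.cycleGraph n, σ u = v := by
  have : NeZero n := ⟨fun h ↦ by subst h; exact u.elim0⟩
  refine ⟨⟨Equiv.addRight (v - u), fun {a b} ↦ ?_⟩, ?_⟩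
  · simp [SimpleGraph.cycleGraph_adj']
  · simp

theorem cycleGraph_connected_of_two_le (hn : 2 ≤ n) : (SimpleGraph.cycleGraph n).Connected := by
  obtain ⟨m, rfl⟩ := Nat.exists_eq_add_of_le' (show 1 ≤ n by omega)
  exact SimpleGraph.cycleGraph_connected

/-- The proper connected sets of vertices of a cycle are cyclic intervals. -/
theorem exists_eq_arc (hn : 2 ≤ n) {F : Finset (Fin n)}
    (hF : F ∈ connectedSets (SimpleGraph.cycleGraph n)) (hF' : F ≠ univ) :
    ∃ i j, i ≠ j ∧ F = arc i j := by
  have hne := nonempty_of_mem_connectedSets hF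
  have hc : (Fᶜ).Nonempty := by rwa [nonempty_iff_ne_empty, Ne, compl_eq_empty_iff]
  let z : Fin n := ⟨0, by omega⟩
  have hz : z.val = 0 := rfl
  -- If `0 ∈ F`, then `F` may wrap around and is described by the extremes `p`, `q` of its
  -- complement; otherwise it is an ordinary interval.
  by_cases h0 : z ∈ F
  · set p := Fᶜ.min' hc
    set q := Fᶜ.max' hc
    have hp : p ∉ F := mem_compl.1 (Fᶜ.min'_mem hc)
    have hq : q ∉ F := mem_compl.1 (Fᶜ.max'_mem hc)
    have hmem : ∀ m : Fin n, m.val < p ∨ q.val < m → m ∈ F := by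
      intro m hm
      by_contra hmF
      have h1 := Fin.le_def.1 (Fᶜ.min'_le m (mem_compl.2 hmF))
      have h2 := Fin.le_def.1 (Fᶜ.le_max' m (mem_compl.2 hmF))
      change p.val ≤ m at h1
      change m.val ≤ q at h2
      omega
    have hpz : p.val ≠ 0 := fun h ↦ hp (by rwa [show p = z from Fin.ext h])
    have hpq : p.val ≤ q := Fin.le_def.1 (Fᶜ.min'_le q (Fᶜ.max'_mem hc))
    have hall := forall_mem_of_mem_connectedSets hF (p := fun m ↦ m.val < p ∨ q.val < m) h0
      (Or.inl (by omega)) (by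
        intro u hu v hv huv h
        rw [cycleGraph_adj_iff hn] at huv
        have h1 : v.val ≠ p := fun h ↦ hp (by rwa [← Fin.ext h])
        have h2 : v.val ≠ q := fun h ↦ hq (by rwa [← Fin.ext h])
        have h3 := u.isLt
        have h4 := v.isLt
        have h5 := q.isLt
        omega)
    have hF_iff : ∀ m : Fin n, m ∈ F ↔ m.val < p ∨ q.val < m := fun m ↦ ⟨hall m, hmem m⟩
    -- The endpoint `q + 1` must be read modulo `n`.
    by_cases hqn : q.val + 1 = n
    · refine ⟨z, p, fun h ↦ hpz (by rw [← h]), ?_⟩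
      ext m
      rw [hF_iff, mem_arc]
      have := m.isLt
      omega
    · have := q.isLt
      refine ⟨⟨q.val + 1, by omega⟩, p, fun h ↦ ?_, ?_⟩
      · have := congrArg Fin.val h
        simp only at this
        omega
      · ext m
        rw [hF_iff, mem_arc]
        simp only
        omega
  · set a := F.min' hne
    set b := F.max' hne
    have ha : a ∈ F := F.min'_mem hne
    have hb : b ∈ F := F.max'_mem hne
    have hle : ∀ m ∈ F, a.val ≤ m ∧ m.val ≤ b := fun m hm ↦
      ⟨Fin.le_def.1 (F.min'_le m hm), Fin.le_def.1 (F.le_max' m hm)⟩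
    have hall := forall_mem_of_mem_connectedSets hF
      (p := fun m ↦ ∀ k : Fin n, a.val ≤ k → k.val ≤ m → k ∈ F) ha
      (fun k h1 h2 ↦ by rwa [show k = a from Fin.ext (le_antisymm h2 h1)])
      (by
        intro u hu v hv huv h k h1 h2
        rw [cycleGraph_adj_iff hn] at huv
        have hu0 : u.val ≠ 0 := fun h ↦ h0 (by rwa [show z = u from Fin.ext h.symm])
        have hv0 : v.val ≠ 0 := fun h ↦ h0 (by rwa [show z = v from Fin.ext h.symm])
        by_cases hkv : k = v
        · rwa [hkv]
        · have := Fin.val_ne_of_ne hkv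
          exact h k h1 (by omega))
    have hF_iff : ∀ m : Fin n, m ∈ F ↔ a.val ≤ m ∧ m.val ≤ b := fun m ↦
      ⟨hle m, fun h ↦ hall b hb m h.1 h.2⟩
    have ha0 : a.val ≠ 0 := fun h ↦ h0 (by rwa [show z = a from Fin.ext h.symm])
    have hab := (hle a ha).2
    by_cases hbn : b.val + 1 = n
    · refine ⟨a, z, fun h ↦ ha0 (by rw [h]), ?_⟩
      ext m
      rw [hF_iff, mem_arc]
      have := m.isLt
      omega
    · have := b.isLt
      refine ⟨a, ⟨b.val + 1, by omega⟩, fun h ↦ ?_, ?_⟩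
      · have := congrArg Fin.val h
        simp only at this
        omega
      · ext m
        rw [hF_iff, mem_arc]
        simp only
        omega

theorem facetDistance_arc_pos (hn : 2 ≤ n) {i j : Fin n} (h : i ≠ j) :
    0 < facetDistance (SimpleGraph.cycleGraph n) (arc i j) :=
  facetDistance_pos (cycleGraph_connected_of_two_le hn) cycleGraph_transitive
    ⟨i, left_mem_arc h⟩ fun hu ↦ right_notMem_arc i j (hu ▸ mem_univ j)

/-- A vertex and its predecessor on the cycle. -/
theorem exists_adj_pred (hn : 2 ≤ n) (j : Fin n) :
    ∃ p : Fin n, (SimpleGraph.cycleGraph n).Adj p j ∧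
      ((p.val + 1 = j) ∨ (j.val = 0 ∧ p.val + 1 = n)) := by
  have := j.isLt
  by_cases h : j.val = 0
  · refine ⟨⟨n - 1, by omega⟩, ?_, ?_⟩
    · rw [cycleGraph_adj_iff hn]
      simp only
      omega
    · simp only
      omega
  · refine ⟨⟨j.val - 1, by omega⟩, ?_, ?_⟩
    · rw [cycleGraph_adj_iff hn]
      simp only
      omega
    · simp only
      omega

/-- Strict submodularity applies to `arc i j` and `arc j k`. In cyclic order `i, j, k` they are
disjoint with union `arc i k`; otherwise they cover the cycle and meet in `arc i k`. Both `∅` and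
`univ` have distance zero. -/
theorem facetDistance_arc_lt_add (hn : 2 ≤ n) {i j k : Fin n} (hij : i ≠ j) (hjk : j ≠ k)
    (hki : k ≠ i) :
    facetDistance (SimpleGraph.cycleGraph n) (arc i k) <
      facetDistance (SimpleGraph.cycleGraph n) (arc i j) +
        facetDistance (SimpleGraph.cycleGraph n) (arc j k) := by
  have : Nonempty (Fin n) := ⟨i⟩
  have hij := Fin.val_ne_of_ne hij
  have hjk := Fin.val_ne_of_ne hjk
  have hki := Fin.val_ne_of_ne hki
  have hi := i.isLt
  have hj := j.isLt
  have hk := k.isLt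
  by_cases h : (i.val < j ∧ j.val < k) ∨ (j.val < k ∧ k.val < i) ∨ (k.val < i ∧ i.val < j)
  · have h1 : arc i j ∩ arc j k = ∅ := by
      ext m
      simp only [mem_inter, mem_arc, notMem_empty, iff_false]
      omega
    have h2 : arc i j ∪ arc j k = arc i k := by
      ext m
      simp only [mem_union, mem_arc]
      omega
    -- The edge `{p, j}` straddles the junction of the two arcs, so it lies in neither.
    obtain ⟨p, hpj, hp⟩ := exists_adj_pred hn j
    have hpn := p.isLt
    have := facetDistance_inter_add_union_lt (pair_mem_connectedSets hpj) (A := arc i j)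
      (B := arc j k) (by
        intro m hm
        rw [mem_insert, mem_singleton] at hm
        rw [mem_union, mem_arc, mem_arc]
        rcases hm with rfl | rfl <;> omega)
      (fun h ↦ right_notMem_arc i j (h (by simp)))
      (fun h ↦ by
        have := mem_arc.1 (h (mem_insert_self p _))
        omega)
    rwa [h1, h2, facetDistance_empty, zero_add] at this
  · have h1 : arc i j ∩ arc j k = arc i k := by
      ext m
      simp only [mem_inter, mem_arc]
      omega
    have h2 : arc i j ∪ arc j k = univ := by
      ext m
      simp only [mem_union, mem_arc, mem_univ, iff_true]
      omega
    have := facetDistance_inter_add_union_lt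
      (univ_mem_connectedSets (cycleGraph_connected_of_two_le hn)) (A := arc i j)
      (B := arc j k) h2.ge (fun h ↦ right_notMem_arc i j (h (mem_univ j)))
      (fun h ↦ right_notMem_arc j k (h (mem_univ k)))
    rwa [h1, h2, facetDistance_univ, add_zero] at this

theorem isQuasiMetric_facetDistance_arc (hn : 2 ≤ n) :
    IsQuasiMetric fun i j : Fin n ↦ facetDistance (SimpleGraph.cycleGraph n) (arc i j) := by
  have hself : ∀ i : Fin n, facetDistance (SimpleGraph.cycleGraph n) (arc i i) = 0 := fun i ↦ by
    rw [arc_self, facetDistance_empty]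
  have hnonneg : ∀ i j : Fin n, 0 ≤ facetDistance (SimpleGraph.cycleGraph n) (arc i j) := by
    intro i j
    rcases eq_or_ne i j with rfl | h
    · exact (hself i).ge
    · exact (facetDistance_arc_pos hn h).le
  refine ⟨hnonneg, fun i j ↦ ⟨fun h ↦ ?_, ?_⟩, fun i j k ↦ ?_⟩
  · by_contra hij
    exact (facetDistance_arc_pos hn hij).ne' h
  · rintro rfl
    exact hself i
  · rcases eq_or_ne i j with rfl | hij
    · rw [hself, zero_add]
    rcases eq_or_ne j k with rfl | hjk
    · rw [hself, add_zero]
    rcases eq_or_ne k i with rfl | hki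
    · rw [hself]
      exact add_nonneg (hnonneg _ _) (hnonneg _ _)
    exact (facetDistance_arc_lt_add hn hij hjk hki).le

end Arcs

/-! ### The polar dual of the Minkowski sum -/

section Duality

variable {n : ℕ} {G : SimpleGraph (Fin n)}

/-- The indicator vector of a set of coordinates. -/
noncomputable def indicatorVec (F : Finset (Fin n)) : EuclideanSpace ℝ (Fin n) :=
  WithLp.toLp 2 fun m ↦ if m ∈ F then 1 else 0

theorem indicatorVec_apply (F : Finset (Fin n)) (m : Fin n) :
    indicatorVec F m = if m ∈ F then 1 else 0 := rfl

theorem sum_indicatorVec (F : Finset (Fin n)) : ∑ m, indicatorVec F m = #F := by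
  simp [indicatorVec_apply]

theorem center_apply (x : EuclideanSpace ℝ (Fin n)) (m : Fin n) :
    center x m = x m - (∑ i, x i) / n := by
  simp [center, Finset.sum_apply, Pi.single_apply]

theorem center_mem_H₀ (hn : n ≠ 0) (x : EuclideanSpace ℝ (Fin n)) : center x ∈ H₀ n := by
  have : (n : ℝ) ≠ 0 := by exact_mod_cast hn
  simp only [H₀, Set.mem_ofPred_eq, center_apply, sum_sub_distrib, sum_const, card_univ,
    Fintype.card_fin, nsmul_eq_mul]
  field_simp
  ring

theorem center_sub (x y : EuclideanSpace ℝ (Fin n)) : center (x - y) = center x - center y := by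
  ext m
  simp only [center_apply, PiLp.sub_apply, sum_sub_distrib]
  ring

theorem center_smul (c : ℝ) (x : EuclideanSpace ℝ (Fin n)) : center (c • x) = c • center x := by
  ext m
  simp only [center_apply, PiLp.smul_apply, smul_eq_mul, ← mul_sum]
  ring

theorem inner_center {y : EuclideanSpace ℝ (Fin n)} (hy : y ∈ H₀ n)
    (x : EuclideanSpace ℝ (Fin n)) : inner ℝ y (center x) = ∑ m, y m * x m := by
  have hy : ∑ m, y m = 0 := hy
  rw [PiLp.inner_apply]
  simp only [center_apply, RCLike.inner_apply, conj_trivial, sub_mul, sum_sub_distrib]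
  rw [← mul_sum, hy, mul_zero, sub_zero]
  exact sum_congr rfl fun _ _ ↦ mul_comm _ _

theorem convex_polarDual (K : Set (EuclideanSpace ℝ (Fin n))) : Convex ℝ (polarDual K) := by
  intro x hx y hy a b ha hb hab
  have hx0 : ∑ m, x m = 0 := hx.1
  have hy0 : ∑ m, y m = 0 := hy.1
  refine ⟨?_, fun w hw ↦ ?_⟩
  · simp [H₀, sum_add_distrib, ← mul_sum, hx0, hy0]
  · rw [inner_add_left, real_inner_smul_left, real_inner_smul_left]
    nlinarith [hx.2 w hw, hy.2 w hw]

theorem mem_simplex {V : Type*} [Fintype V] [DecidableEq V] {F : Finset V}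
    {x : EuclideanSpace ℝ V} (hx : x ∈ simplex F) :
    (∀ i, 0 ≤ x i) ∧ ∑ i, x i = 1 ∧ ∀ i ∉ F, x i = 0 := by
  have hconv : Convex ℝ {x : EuclideanSpace ℝ V |
      (∀ i, 0 ≤ x i) ∧ ∑ i, x i = 1 ∧ ∀ i ∉ F, x i = 0} := by
    rintro x ⟨hx0, hx1, hxF⟩ y ⟨hy0, hy1, hyF⟩ a b ha hb hab
    refine ⟨fun i ↦ ?_, ?_, fun i hi ↦ ?_⟩
    · have := hx0 i
      have := hy0 i
      simp only [PiLp.add_apply, PiLp.smul_apply, smul_eq_mul]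
      positivity
    · simp [sum_add_distrib, ← mul_sum, hx1, hy1, hab]
    · simp [hxF i hi, hyF i hi]
  refine convexHull_min ?_ hconv hx
  rintro _ ⟨i, hi, rfl⟩
  refine ⟨fun j ↦ ?_, ?_, fun j hj ↦ ?_⟩
  · simp only [PiLp.single_apply]
    split_ifs <;> norm_num
  · simp
  · rw [PiLp.single_apply, if_neg]
    rintro rfl
    exact hj hi

/-- The facet inequalities of the graph associahedron, and its affine span. -/
theorem sum_of_mem_sum_simplex {x : EuclideanSpace ℝ (Fin n)}
    (hx : x ∈ ∑ A ∈ connectedSets G, simplex A) :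
    ∑ m, x m = #(connectedSets G) ∧ ∀ F : Finset (Fin n), (tubeCount G F : ℝ) ≤ ∑ m ∈ F, x m := by
  obtain ⟨g, hg, rfl⟩ := (Set.mem_finsetSum _ _ _).1 hx
  have happ : ∀ m, (∑ A ∈ connectedSets G, g A) m = ∑ A ∈ connectedSets G, g A m := fun m ↦ by
    simp
  simp only [happ]
  refine ⟨?_, fun F ↦ ?_⟩
  · rw [sum_comm, sum_congr rfl fun A hA ↦ (mem_simplex (hg hA)).2.1]
    simp
  · have : (tubeCount G F : ℝ) = ∑ A ∈ connectedSets G, if A ⊆ F then (1 : ℝ) else 0 := by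
      simp [tubeCount]
    rw [this, sum_comm]
    refine sum_le_sum fun A hA ↦ ?_
    obtain ⟨h0, h1, hF⟩ := mem_simplex (hg hA)
    split_ifs with h
    · rw [← h1]
      exact (sum_subset (subset_univ F) fun i _ hi ↦ hF i fun hA ↦ hi (h hA)).ge
    · exact sum_nonneg fun i _ ↦ h0 i

theorem inv_smul_neg_center_mem_polarDual (hn : n ≠ 0) {F : Finset (Fin n)}
    (hF : 0 < facetDistance G F) :
    (facetDistance G F)⁻¹ • -center (indicatorVec F) ∈
      polarDual (center '' ∑ A ∈ connectedSets G, simplex A) := by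
  have hmem : center (-(facetDistance G F)⁻¹ • indicatorVec F) ∈ H₀ n := center_mem_H₀ hn _
  rw [center_smul, neg_smul, ← smul_neg] at hmem
  refine ⟨hmem, ?_⟩
  rintro _ ⟨x, hx, rfl⟩
  obtain ⟨hsum, hx⟩ := sum_of_mem_sum_simplex hx
  have hF' := hx F
  rw [inner_center hmem]
  have : ∑ m, ((facetDistance G F)⁻¹ • -center (indicatorVec F)) m * x m =
      (facetDistance G F)⁻¹ * ((#(connectedSets G) : ℝ) / n * #F - ∑ m ∈ F, x m) := by
    simp only [PiLp.smul_apply, PiLp.neg_apply, center_apply, smul_eq_mul, sum_const, nsmul_eq_mul,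
      mul_assoc, ← mul_sum, neg_sub, sub_mul, sum_sub_distrib, hsum, indicatorVec_apply, ite_mul,
      one_mul, zero_mul, sum_ite_mem, univ_inter]
    ring
  rw [this, inv_mul_le_one₀ hF, facetDistance, Fintype.card_fin]
  linarith

/-- The support function of the polar dual: a vector with non-negative coordinates, not all
positive, is decomposed along connected sets of vertices contained in its support. -/
theorem neg_center_mem_smul {P : Set (EuclideanSpace ℝ (Fin n))} (hP : Convex ℝ P)
    (hPne : P.Nonempty)
    (hfacet : ∀ F ∈ connectedSets G, F ≠ univ →
      0 ≤ facetDistance G F ∧ -center (indicatorVec F) ∈ facetDistance G F • P)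
    (k : ℕ) : ∀ (z : EuclideanSpace ℝ (Fin n)) (μ : Finset (Fin n) → ℝ),
    (∀ m, 0 ≤ z m) → (∃ m, z m = 0) → (∀ A ∈ connectedSets G, IsLeast (z '' A) (μ A)) →
    #{m | z m ≠ 0} ≤ k →
    0 ≤ (#(connectedSets G) : ℝ) / n * ∑ m, z m - ∑ A ∈ connectedSets G, μ A ∧
    -center z ∈
      ((#(connectedSets G) : ℝ) / n * ∑ m, z m - ∑ A ∈ connectedSets G, μ A) • P := by
  induction k with
  | zero =>
    intro z μ _ _ hμ hk
    have hz : z = 0 := by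
      ext m
      by_contra h
      rw [nonpos_iff_eq_zero, card_eq_zero, filter_eq_empty_iff] at hk
      exact hk (mem_univ m) h
    subst hz
    have hμ0 : ∀ A ∈ connectedSets G, μ A = 0 := by
      intro A hA
      obtain ⟨m, -, hm⟩ := (hμ A hA).1
      exact hm.symm
    have hc : center (0 : EuclideanSpace ℝ (Fin n)) = 0 := by
      ext m
      simp [center_apply]
    rw [sum_congr rfl hμ0, hc]
    simp [Set.zero_smul_set hPne]
  | succ k ih =>
    intro z μ hz hz0 hμ hk
    by_cases hS : ∀ m, z m = 0
    · refine ih z μ hz hz0 hμ ?_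
      simp [hS]
    push Not at hS
    obtain ⟨v, hv⟩ := hS
    -- Greedy step: take a maximal connected `F` in the support of `z` and subtract `μ F` times its
    -- indicator.
    obtain ⟨F, -, hFmax⟩ := Finset.exists_le_maximal
      {A ∈ connectedSets G | A ⊆ ({m | z m ≠ 0} : Finset (Fin n))} (a := {v})
      (mem_filter.2 ⟨singleton_mem_connectedSets v, by simpa using hv⟩)
    obtain ⟨hFB, hFS⟩ := mem_filter.1 hFmax.prop
    have hFz : ∀ m ∈ F, z m ≠ 0 := fun m hm ↦ (mem_filter.1 (hFS hm)).2
    obtain ⟨w, hwF, hw⟩ := (hμ F hFB).1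
    have hμF : ∀ m ∈ F, μ F ≤ z m := fun m hm ↦ (hμ F hFB).2 ⟨m, hm, rfl⟩
    have hμ0 : 0 ≤ μ F := hw ▸ hz w
    obtain ⟨q, hq⟩ := hz0
    have hqF : q ∉ F := fun h ↦ hFz q h hq
    obtain ⟨hfd, hFP⟩ := hfacet F hFB fun h ↦ hqF (h ▸ mem_univ q)
    set z' : EuclideanSpace ℝ (Fin n) := z - μ F • indicatorVec F with hz'
    have hzF : ∀ m ∈ F, z' m = z m - μ F := fun m hm ↦ by simp [hz', indicatorVec_apply, hm]
    have hznF : ∀ m ∉ F, z' m = z m := fun m hm ↦ by simp [hz', indicatorVec_apply, hm]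
    have hz'0 : ∀ m, 0 ≤ z' m := by
      intro m
      by_cases hm : m ∈ F
      · rw [hzF m hm]
        exact sub_nonneg.2 (hμF m hm)
      · rw [hznF m hm]
        exact hz m
    -- Only the minima over subsets of `F` change. If `A` meets `F` without lying in it, maximality
    -- forces a zero of `z` in `A ∪ F`, hence in `A`, so the minimum over `A` is zero before and
    -- after.
    let μ' : Finset (Fin n) → ℝ := fun A ↦ μ A - if A ⊆ F then μ F else 0
    have hleast : ∀ A ∈ connectedSets G, IsLeast (z' '' A) (μ' A) := by
      intro A hA
      by_cases hAF : A ⊆ F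
      · simp only [μ', if_pos hAF]
        obtain ⟨⟨a, haA, ha⟩, hle⟩ := hμ A hA
        refine ⟨⟨a, haA, (hzF a (hAF haA)).trans (by rw [ha])⟩, ?_⟩
        rintro _ ⟨b, hb, rfl⟩
        exact (sub_le_sub_right (hle ⟨b, hb, rfl⟩) _).trans_eq (hzF b (hAF hb)).symm
      · simp only [μ', if_neg hAF, sub_zero]
        by_cases hint : (A ∩ F).Nonempty
        · have hU := union_mem_connectedSets hA hFB hint
          have hUS : ¬ A ∪ F ⊆ ({m | z m ≠ 0} : Finset (Fin n)) := fun h ↦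
            hAF (subset_union_left.trans (hFmax.le_of_ge (mem_filter.2 ⟨hU, h⟩)
              subset_union_right))
          obtain ⟨p, hpU, hp⟩ := not_subset.1 hUS
          have hzp : z p = 0 := by simpa using hp
          have hpF : p ∉ F := fun h ↦ hFz p h hzp
          have hpA : p ∈ A := (mem_union.1 hpU).resolve_right hpF
          obtain ⟨⟨a, haA, ha⟩, hle⟩ := hμ A hA
          have hμA : μ A = 0 :=
            le_antisymm (hzp ▸ hle ⟨p, hpA, rfl⟩) (ha ▸ hz a)
          rw [hμA]
          refine ⟨⟨p, hpA, (hznF p hpF).trans hzp⟩, ?_⟩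
          rintro _ ⟨b, -, rfl⟩
          exact hz'0 b
        · have : z' '' A = z '' A := Set.image_congr fun a ha ↦ hznF a fun haF ↦
            hint ⟨a, mem_inter.2 ⟨ha, haF⟩⟩
          rw [this]
          exact hμ A hA
    -- The minimiser `w` of `z` on `F` leaves the support.
    have hcard : #{m | z' m ≠ 0} ≤ k := by
      refine Nat.le_of_lt_succ (lt_of_lt_of_le (card_lt_card ?_) hk)
      refine (ssubset_iff_of_subset fun m hm ↦ ?_).2 ⟨w, ?_, ?_⟩
      · rw [mem_filter] at hm ⊢
        by_cases hmF : m ∈ F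
        · exact ⟨mem_univ _, hFz m hmF⟩
        · rw [← hznF m hmF]
          exact hm
      · exact hFS hwF
      · rw [mem_filter, hzF w hwF, hw, sub_self]
        simp
    obtain ⟨hs, hmem⟩ := ih z' μ' hz'0 ⟨q, by rw [hznF q hqF, hq]⟩ hleast hcard
    set s := (#(connectedSets G) : ℝ) / n * ∑ m, z' m - ∑ A ∈ connectedSets G, μ' A with hs_def
    have hsum : (#(connectedSets G) : ℝ) / n * ∑ m, z m - ∑ A ∈ connectedSets G, μ A =
        s + μ F * facetDistance G F := by
      have h1 : ∑ m, z' m = ∑ m, z m - μ F * #F := by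
        rw [← sum_indicatorVec, mul_sum, ← sum_sub_distrib]
        rfl
      have h2 : ∑ A ∈ connectedSets G, μ' A =
          ∑ A ∈ connectedSets G, μ A - μ F * tubeCount G F := by
        simp only [μ', sum_sub_distrib, ← sum_filter, sum_const, nsmul_eq_mul, tubeCount]
        ring
      rw [hs_def, h1, h2, facetDistance, Fintype.card_fin]
      ring
    have hsF := mul_nonneg hμ0 hfd
    rw [hsum]
    refine ⟨add_nonneg hs hsF, ?_⟩
    -- Convexity and non-negative factors split the dilate of `P` as a Minkowski sum.
    rw [hP.add_smul hs hsF, mul_smul]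
    refine Set.mem_add.2 ⟨_, hmem, _, Set.smul_mem_smul_set hFP, ?_⟩
    rw [hz', center_sub, center_smul, smul_neg]
    abel

/-- Subtracting `y` from its maximum gives a vector `z` to which the greedy decomposition applies.
The dilation factor becomes the sum of the maxima of `y` over the connected sets, which is at most
`1` because a point of the Minkowski sum attains it. -/
theorem polarDual_subset {P : Set (EuclideanSpace ℝ (Fin n))} (hn : n ≠ 0) (hP : Convex ℝ P)
    (h0 : 0 ∈ P)
    (hfacet : ∀ F ∈ connectedSets G, F ≠ univ →
      0 ≤ facetDistance G F ∧ -center (indicatorVec F) ∈ facetDistance G F • P) :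
    polarDual (center '' ∑ A ∈ connectedSets G, simplex A) ⊆ P := by
  rintro y ⟨hy, hle⟩
  have hn' : (n : ℝ) ≠ 0 := by exact_mod_cast hn
  have hy0 : ∑ m, y m = 0 := hy
  have : Nonempty (Fin n) := ⟨⟨0, Nat.pos_of_ne_zero hn⟩⟩
  obtain ⟨t, ht⟩ := Finite.exists_max fun m ↦ y m
  have hmax : ∀ A : Finset (Fin n), ∃ a, A ∈ connectedSets G → a ∈ A ∧ ∀ b ∈ A, y b ≤ y a := by
    intro A
    by_cases hA : A ∈ connectedSets G
    · obtain ⟨a, ha, h⟩ := exists_max_image A (fun m ↦ y m) (nonempty_of_mem_connectedSets hA)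
      exact ⟨a, fun _ ↦ ⟨ha, h⟩⟩
    -- `t` is a dummy value here.
    · exact ⟨t, fun h ↦ absurd h hA⟩
  choose g hg using hmax
  have hvertex : ∑ A ∈ connectedSets G, y (g A) ≤ 1 := by
    have hx : ∑ A ∈ connectedSets G, EuclideanSpace.single (g A) (1 : ℝ) ∈
        ∑ A ∈ connectedSets G, simplex A :=
      (Set.mem_finsetSum _ _ _).2
        ⟨_, fun hA ↦ subset_convexHull ℝ _ ⟨_, (hg _ hA).1, rfl⟩, rfl⟩
    have := hle _ ⟨_, hx, rfl⟩
    rw [inner_center hy] at this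
    refine le_of_eq_of_le ?_ this
    simp only [WithLp.ofLp_sum, Finset.sum_apply, mul_sum]
    rw [sum_comm]
    refine sum_congr rfl fun A _ ↦ ?_
    simp
  let z : EuclideanSpace ℝ (Fin n) := WithLp.toLp 2 fun m ↦ y t - y m
  have hz : ∀ m, z m = y t - y m := fun _ ↦ rfl
  obtain ⟨hs0, hmem⟩ := neg_center_mem_smul hP ⟨0, h0⟩ hfacet _ z (fun A ↦ z (g A))
    (fun m ↦ sub_nonneg.2 (ht m)) ⟨t, sub_self _⟩
    (fun A hA ↦ ⟨⟨_, (hg A hA).1, rfl⟩, by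
      rintro _ ⟨b, hb, rfl⟩
      exact sub_le_sub_left ((hg A hA).2 b hb) _⟩) le_rfl
  have hzsum : ∑ m, z m = n * y t := by
    simp [hz, sum_sub_distrib, hy0]
  have hs : (#(connectedSets G) : ℝ) / n * ∑ m, z m - ∑ A ∈ connectedSets G, z (g A) =
      ∑ A ∈ connectedSets G, y (g A) := by
    rw [hzsum]
    simp only [hz, sum_sub_distrib, sum_const, nsmul_eq_mul]
    field_simp
    ring
  have hyz : -center z = y := by
    ext m
    rw [PiLp.neg_apply, center_apply, hzsum, hz]
    field_simp
    ring
  rw [hs] at hs0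
  rw [hs, hyz] at hmem
  obtain ⟨p, hp, hpy⟩ := hmem
  rw [← hpy]
  exact hP.smul_mem_of_zero_mem h0 hp ⟨hs0, hvertex⟩

end Duality

/-! ### The linear isomorphism from roots to arcs -/

section Telescoping

variable {n : ℕ}

/-- The linear map sending `e_i` to the centred indicator vector of `{0, …, i - 1}`. -/
noncomputable def telescope (n : ℕ) :
    EuclideanSpace ℝ (Fin n) →ₗ[ℝ] EuclideanSpace ℝ (Fin n) where
  toFun x := ∑ i, x i • center (indicatorVec (univ.filter fun m : Fin n ↦ m.val < i.val))
  map_add' x y := by simp [add_smul, sum_add_distrib]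
  map_smul' c x := by simp [smul_sum, mul_smul]

theorem telescope_apply (x : EuclideanSpace ℝ (Fin n)) :
    telescope n x =
      ∑ i, x i • center (indicatorVec (univ.filter fun m : Fin n ↦ m.val < i.val)) := rfl

theorem telescope_single (i : Fin n) :
    telescope n (EuclideanSpace.single i 1) =
      center (indicatorVec (univ.filter fun m : Fin n ↦ m.val < i.val)) := by
  rw [telescope_apply, sum_eq_single i]
  · simp
  · intro j _ hj
    simp [hj]
  · simp

theorem telescope_single_sub_single (hn : n ≠ 0) {i j : Fin n} (hij : i ≠ j) :
    telescope n (EuclideanSpace.single i 1 - EuclideanSpace.single j 1) =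
      -center (indicatorVec (arc i j)) := by
  have hn' : (n : ℝ) ≠ 0 := by exact_mod_cast hn
  have hij := Fin.val_ne_of_ne hij
  rw [map_sub, telescope_single, telescope_single, ← center_sub]
  -- For `j < i` the arc wraps around, and the difference of initial segments is off by the all-ones
  -- vector, which centring kills.
  have key : ∀ m, (indicatorVec (univ.filter fun m : Fin n ↦ m.val < i.val) -
      indicatorVec (univ.filter fun m : Fin n ↦ m.val < j.val)) m =
      (if j.val < i then 1 else 0) - indicatorVec (arc i j) m := by
    intro m
    simp only [PiLp.sub_apply, indicatorVec_apply, mem_filter, mem_univ, true_and, mem_arc]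
    split_ifs <;> first | omega | norm_num
  ext m
  rw [PiLp.neg_apply, center_apply, center_apply, key, sum_congr rfl fun m _ ↦ key m]
  simp only [sum_sub_distrib, sum_const, card_univ, Fintype.card_fin, nsmul_eq_mul]
  field_simp
  ring

theorem injOn_telescope : Set.InjOn (telescope n) (H₀ n) := by
  have key : ∀ x : EuclideanSpace ℝ (Fin n), x ∈ H₀ n → telescope n x = 0 → x = 0 := by
    intro x hx h
    have hx : ∑ i, x i = 0 := hx
    -- Differences of coordinates cancel the centring, so all tail sums of `x` agree. Consecutive
    -- ones give `x m = 0` for `m ≠ 0`, and the zero total settles the rest.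
    have hpart : ∀ m m' : Fin n, ∑ i, (if m.val < i.val then x i else 0) =
        ∑ i, (if m'.val < i.val then x i else 0) := by
      intro m m'
      have := congrArg (fun y : EuclideanSpace ℝ (Fin n) ↦ y m - y m') h
      simp only [telescope_apply, WithLp.ofLp_sum, Finset.sum_apply, PiLp.smul_apply,
        center_apply, indicatorVec_apply, mem_filter, mem_univ, true_and, smul_eq_mul, mul_sub,
        sum_sub_distrib, mul_ite, mul_one, mul_zero, PiLp.zero_apply] at this
      linarith
    have hpos : ∀ m : Fin n, m.val ≠ 0 → x m = 0 := by
      intro m hm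
      have hmn := m.isLt
      have := hpart ⟨m.val - 1, by omega⟩ m
      rw [← sub_eq_zero, ← sum_sub_distrib, sum_eq_single m] at this
      · simpa [show m.val - 1 < m.val by omega] using this
      · intro i _ hi
        have := Fin.val_ne_of_ne hi
        simp only
        split_ifs <;> first | omega | simp
      · simp
    ext m
    by_cases hm : m.val = 0
    · rw [sum_eq_single m (fun i _ hi ↦ hpos i fun h ↦ hi (Fin.ext (h.trans hm.symm)))
        (by simp)] at hx
      exact hx
    · exact hpos m hm
  intro x hx y hy hxy
  refine sub_eq_zero.1 (key _ ?_ (by rw [map_sub, hxy, sub_self]))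
  have hx : ∑ i, x i = 0 := hx
  have hy : ∑ i, y i = 0 := hy
  simp [H₀, sum_sub_distrib, hx, hy]

theorem KR_subset_H₀ (ρ : Fin n → Fin n → ℝ) : KR ρ ⊆ H₀ n := by
  refine convexHull_min ?_ ?_
  · rintro _ ⟨i, j, -, rfl⟩
    simp [H₀, ← mul_sum, sum_sub_distrib]
  · intro x hx y hy a b _ _ _
    have hx : ∑ i, x i = 0 := hx
    have hy : ∑ i, y i = 0 := hy
    simp [H₀, sum_add_distrib, ← mul_sum, hx, hy]

theorem zero_mem_KR {X : Type*} [Fintype X] [DecidableEq X] [Nontrivial X] {ρ : X → X → ℝ}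
    (hρ : ∀ i j, i ≠ j → 0 < ρ i j) : 0 ∈ KR ρ := by
  obtain ⟨i, j, hij⟩ := exists_pair_ne X
  have h1 := hρ i j hij
  have h2 := hρ j i hij.symm
  have := convex_convexHull ℝ _ (subset_convexHull ℝ _ ⟨i, j, hij, rfl⟩ : _ ∈ KR ρ)
    (subset_convexHull ℝ _ ⟨j, i, hij.symm, rfl⟩ : _ ∈ KR ρ)
    -- These weights make the two opposite generators cancel.
    (a := ρ i j / (ρ i j + ρ j i)) (b := ρ j i / (ρ i j + ρ j i))
    (by positivity) (by positivity) (by field_simp)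
  refine Set.mem_of_eq_of_mem ?_ this
  rw [smul_smul, smul_smul, div_mul_eq_mul_div, div_mul_eq_mul_div, mul_inv_cancel₀ h1.ne',
    mul_inv_cancel₀ h2.ne', ← smul_add]
  simp

theorem telescope_image_KR (hn : 2 ≤ n) :
    telescope n '' KR (fun i j ↦ facetDistance (SimpleGraph.cycleGraph n) (arc i j)) =
      dualCyclohedron n := by
  have hn0 : n ≠ 0 := by omega
  have : Nontrivial (Fin n) := Fin.nontrivial_iff_two_le.2 hn
  refine Set.Subset.antisymm ?_ (polarDual_subset hn0 ?_ ?_ ?_)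
  · rw [KR, LinearMap.image_convexHull]
    refine convexHull_min ?_ (convex_polarDual _)
    rintro _ ⟨_, ⟨i, j, hij, rfl⟩, rfl⟩
    rw [map_smul, telescope_single_sub_single hn0 hij]
    exact inv_smul_neg_center_mem_polarDual hn0 (facetDistance_arc_pos hn hij)
  · exact (convex_convexHull ℝ _).linear_image _
  · exact ⟨0, zero_mem_KR fun i j hij ↦ facetDistance_arc_pos hn hij, map_zero _⟩
  · intro F hF hF'
    obtain ⟨i, j, hij, rfl⟩ := exists_eq_arc hn hF hF'
    have hpos := facetDistance_arc_pos hn hij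
    refine ⟨hpos.le, ?_⟩
    rw [← telescope_single_sub_single hn0 hij]
    refine (Set.mem_smul_set_iff_inv_smul_mem₀ hpos.ne' _ _).2
      ⟨_, subset_convexHull ℝ _ ⟨i, j, hij, rfl⟩, map_smul _ _ _⟩

end Telescoping

end Cyclohedron

theorem theorem5p11 (n : ℕ) (hn : 2 ≤ n) :
    ∃ ρ : Fin n → Fin n → ℝ,
      Cyclohedron.IsQuasiMetric ρ ∧
      Cyclohedron.AffinelyIsomorphic (Cyclohedron.KR ρ) (Cyclohedron.dualCyclohedron n) ∧
      ∀ i j k : Fin n, i ≠ j → j ≠ k → k ≠ i → ρ i k < ρ i j + ρ j k := by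
  refine ⟨fun i j ↦ Cyclohedron.facetDistance (SimpleGraph.cycleGraph n) (Cyclohedron.arc i j),
    Cyclohedron.isQuasiMetric_facetDistance_arc hn,
    ⟨(Cyclohedron.telescope n).toAffineMap, ?_⟩,
    fun i j k ↦ Cyclohedron.facetDistance_arc_lt_add hn⟩
  have h := (Cyclohedron.injOn_telescope.mono (Cyclohedron.KR_subset_H₀ _)).bijOn_image
    (s := Cyclohedron.KR fun i j ↦
      Cyclohedron.facetDistance (SimpleGraph.cycleGraph n) (Cyclohedron.arc i j))
  rwa [Cyclohedron.telescope_image_KR hn] at h
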